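/- Let $k$ be a field, $R=k[x_1,\dots,x_n]$, and let $G$ be a simple graph on the vertex set $\{x_1,\dots,x_n\}$ with edge ideal $I(G)=(x_ax_b \mid \{x_a,x_b\}\text{ is an edge of }G)\subseteq R$. For a monomial ideal $L\subseteq R$ let $\mathcal G(L)$ be its set of minimal monomial generators, and let $\beta_{i,j}(L)=\dim_k \operatorname{Tor}^R_i(k,L)_j$ be its Betti numbers, where $j$ is either a multidegree in $\mathbb N^n$ (with $\deg x_i$ the $i$-th unit vector) or a degree in $\mathbb N$ (with $\deg x_i=1$); put $\beta_{-1,j}(L)=0$. Let $x_v$ be a splitting vertex of $G$, that is, $x_v$ is not isolated in $G$ and the graph $G\setminus\{x_v\}$ has at least one edge. Let $J$ be the ideal generated by all elements of $\mathcal G(I(G))$ divisible by $x_v$ (the edges containing $x_v$), and let $K$ be the ideal generated by $\mathcal G(I(G))\setminus\mathcal G(J)$ (the remaining edges). Then $I(G)=J+K$ is an $x_v$-splitting. That is: $J$ is generated by the elements of $\mathcal G(I(G))$ divisible by $x_v$ and $K$ by the elements of $\mathcal G(I(G))$ not divisible by $x_v$; the ideals $I(G)$, $J$, $K$ are monomial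 with $I(G)=J+K$; $\mathcal G(I(G))$ is the disjoint union of $\mathcal G(J)$ and $\mathcal G(K)$; and $$\beta_{i,j}(I(G))=\beta_{i,j}(J)+\beta_{i,j}(K)+\beta_{i-1,j}(J\cap K)$$ for all $i\ge 0$ and all multidegrees $j\in\mathbb N^n$, and likewise for all $i\ge 0$ and all degrees $j\in\mathbb N$. -/

import Mathlib

open CategoryTheory CategoryTheory.Limits

universe u

/-! ### Multigraded modules over `R = k[x_1, …, x_n]` -/

/-- The category of `ℕⁿ`-graded modules over `R = k[x_1, …, x_n]` (with `deg x_i` the `i`-th unit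
vector) and degree-preserving `R`-linear maps.  Giving such a module `M = ⨁_a M_a` is the same as
giving the `k`-vector spaces `M_a` together with the multiplications
`x^(b - a) : M_a → M_b` for `a ≤ b`, which compose as monomials do, that is, a functor from the
poset `ℕⁿ` to `k`-vector spaces. -/
abbrev MultigradedModule (k : Type u) [Field k] (n : ℕ) : Type (u + 1) :=
  (Fin n →₀ ℕ) ⥤ ModuleCat.{u} k

/-- The category of multigraded modules has enough projectives (the module
`⨁_a R(-a) ⊗ M_a` is projective and maps onto `M`). -/
instance MultigradedModule.enoughProjectives (k : Type u) [Field k] (n : ℕ) :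
    EnoughProjectives (MultigradedModule k n) where
  presentation M := by
    let F : (Fin n →₀ ℕ) → MultigradedModule k n := fun a =>
      (evaluationLeftAdjoint (ModuleCat.{u} k) a).obj (M.obj a)
    have hF : ∀ a, Projective (F a) := fun a =>
      (evaluationAdjunctionRight (ModuleCat.{u} k) a).map_projective _
        (inferInstance : Projective (M.obj a))
    let c : ∀ a, F a ⟶ M := fun a =>
      (evaluationAdjunctionRight (ModuleCat.{u} k) a).counit.app M
    have hc : ∀ a, Epi ((c a).app a) := fun a =>
      (SplitEpi.mk _
        ((evaluationAdjunctionRight (ModuleCat.{u} k) a).right_triangle_components M)).epi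
    have hP : Projective (∐ F) := by
      refine ⟨fun f e _ =>
        ⟨Sigma.desc fun a => Projective.factorThru (Sigma.ι F a ≫ f) e, ?_⟩⟩
      refine Sigma.hom_ext _ _ fun a => ?_
      rw [Sigma.ι_desc_assoc, Projective.factorThru_comp]
    have hφ : ∀ a, Epi ((Sigma.desc c).app a) := by
      intro a
      have h1 : (Sigma.ι F a).app a ≫ (Sigma.desc c).app a = (c a).app a := by
        rw [← NatTrans.comp_app, Sigma.ι_desc]
      have h2 := hc a
      rw [← h1] at h2
      exact @epi_of_epi _ _ _ _ _ _ ((Sigma.desc c).app a) h2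
    have : Epi (Sigma.desc c) := NatTrans.epi_of_epi_app _
    exact ⟨{ p := ∐ F, f := Sigma.desc c }⟩

/-- The degree-`j` component `(𝔪M)_j = ∑_{a < j} x^(j - a) M_a` of `𝔪M`, where
`𝔪 = (x_1, …, x_n)`. -/
def MultigradedModule.maximalIdealSMul {k : Type u} [Field k] {n : ℕ}
    (M : MultigradedModule k n) (j : Fin n →₀ ℕ) : Submodule k (M.obj j) :=
  ⨆ (a : Fin n →₀ ℕ) (h : a < j), LinearMap.range (M.map (homOfLE h.le)).hom

/-- A degree-preserving map sends `𝔪M` into `𝔪N`. -/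
theorem MultigradedModule.maximalIdealSMul_le_comap {k : Type u} [Field k] {n : ℕ}
    {M N : MultigradedModule k n} (f : M ⟶ N) (j : Fin n →₀ ℕ) :
    M.maximalIdealSMul j ≤ (N.maximalIdealSMul j).comap (f.app j).hom := by
  refine iSup₂_le fun a h => ?_
  rintro _ ⟨m, rfl⟩
  have h1 : (f.app j).hom ((M.map (homOfLE h.le)).hom m) =
      (N.map (homOfLE h.le)).hom ((f.app a).hom m) := by
    have h2 := f.naturality (homOfLE h.le)
    exact LinearMap.congr_fun (congrArg ModuleCat.Hom.hom h2) m
  rw [Submodule.mem_comap, h1]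
  exact Submodule.mem_iSup_of_mem a (Submodule.mem_iSup_of_mem h ⟨_, rfl⟩)

/-- The functor `M ↦ (k ⊗_R M)_j = (M / 𝔪M)_j`, where `k = R / 𝔪`. -/
def tensorResidueField (k : Type u) [Field k] (n : ℕ) (j : Fin n →₀ ℕ) :
    MultigradedModule k n ⥤ ModuleCat.{u} k where
  obj M := ModuleCat.of k (M.obj j ⧸ M.maximalIdealSMul j)
  map f := ModuleCat.ofHom (Submodule.mapQ _ _ (f.app j).hom
    (MultigradedModule.maximalIdealSMul_le_comap f j))
  map_id M := by
    refine ModuleCat.hom_ext (Submodule.linearMap_qext _ ?_)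
    ext x
    rfl
  map_comp f g := by
    refine ModuleCat.hom_ext (Submodule.linearMap_qext _ ?_)
    ext x
    rfl

instance tensorResidueField.additive (k : Type u) [Field k] (n : ℕ) (j : Fin n →₀ ℕ) :
    (tensorResidueField k n j).Additive where
  map_add := by
    intro M N f g
    refine ModuleCat.hom_ext (Submodule.linearMap_qext _ ?_)
    ext x
    rfl

/-- `Tor_i(k, M)_j`: the `i`-th left derived functor of `M ↦ (k ⊗_R M)_j` on multigraded
modules. -/
noncomputable def torResidueField (k : Type u) [Field k] (n : ℕ) (i : ℕ) (j : Fin n →₀ ℕ) :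
    MultigradedModule k n ⥤ ModuleCat.{u} k :=
  (tensorResidueField k n j).leftDerived i

/-! ### Betti numbers of monomial ideals -/

section BettiNumbers

variable {k : Type u} [Field k] {n : ℕ}

/-- The component `I_a` of multidegree `a` of an ideal `I`: the elements of `I` of the
form `c x^a`. -/
noncomputable def multidegreeComponent (I : Ideal (MvPolynomial (Fin n) k)) (a : Fin n →₀ ℕ) :
    Submodule k (MvPolynomial (Fin n) k) :=
  I.restrictScalars k ⊓ LinearMap.range (MvPolynomial.monomial (R := k) a)

/-- Multiplication by `x^(b - a)` maps `I_a` to `I_b`. -/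
theorem monomial_mul_mem_multidegreeComponent (I : Ideal (MvPolynomial (Fin n) k))
    {a b : Fin n →₀ ℕ} (h : a ≤ b) (f : MvPolynomial (Fin n) k)
    (hf : f ∈ multidegreeComponent I a) :
    LinearMap.mulLeft k (MvPolynomial.monomial (b - a) (1 : k)) f ∈ multidegreeComponent I b := by
  obtain ⟨hI, c, rfl⟩ := hf
  refine ⟨I.mul_mem_left _ hI, c, ?_⟩
  simp [MvPolynomial.monomial_mul, tsub_add_cancel_of_le h]

/-- A monomial ideal `I = ⨁_a I_a` as a multigraded module. -/
noncomputable def multigradedIdeal (I : Ideal (MvPolynomial (Fin n) k)) : MultigradedModule k n where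
  obj a := ModuleCat.of k (multidegreeComponent I a)
  map {a b} h := ModuleCat.ofHom
    ((LinearMap.mulLeft k (MvPolynomial.monomial (b - a) (1 : k))).restrict
      (monomial_mul_mem_multidegreeComponent I (leOfHom h)))
  map_id a := by
    ext x
    simp [LinearMap.restrict_apply]
  map_comp {a b c} f g := by
    ext x
    simp [LinearMap.restrict_apply, ← mul_assoc, MvPolynomial.monomial_mul,
      tsub_add_tsub_cancel (leOfHom g) (leOfHom f)]

/-- The multigraded Betti number `β_{i,j}(I) = dim_k Tor_i(k, I)_j`, for `j ∈ ℕⁿ`. -/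
noncomputable def multigradedBetti (I : Ideal (MvPolynomial (Fin n) k)) (i : ℕ)
    (j : Fin n →₀ ℕ) : Cardinal.{u} :=
  Module.rank k ((torResidueField k n i j).obj (multigradedIdeal I))

/-- The graded Betti number `β_{i,d}(I) = dim_k Tor_i(k, I)_d` for the standard grading, where
`Tor_i(k, I)_d` is the direct sum of the `Tor_i(k, I)_j` over the multidegrees `j` with
`j_1 + ⋯ + j_n = d`. -/
noncomputable def gradedBetti (I : Ideal (MvPolynomial (Fin n) k)) (i d : ℕ) : Cardinal.{u} :=
  ∑ j ∈ Finset.finsuppAntidiag (Finset.univ : Finset (Fin n)) d, multigradedBetti I i j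

/-! ### Splittings of monomial ideals -/

/-- An ideal generated by monomials. -/
def IsMonomialIdeal (I : Ideal (MvPolynomial (Fin n) k)) : Prop :=
  ∃ S : Set (Fin n →₀ ℕ), I = Ideal.span ((fun a => MvPolynomial.monomial a (1 : k)) '' S)

/-- `𝒢(I)`, the minimal monomial generators of a monomial ideal `I`: the monomials in `I` that are
not divisible by any other monomial in `I`. -/
def minimalGenerators (I : Ideal (MvPolynomial (Fin n) k)) : Set (MvPolynomial (Fin n) k) :=
  {m | (∃ a, m = MvPolynomial.monomial a (1 : k)) ∧ m ∈ I ∧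
    ∀ b, MvPolynomial.monomial b (1 : k) ∈ I → MvPolynomial.monomial b (1 : k) ∣ m →
      MvPolynomial.monomial b (1 : k) = m}

/-- `I = J + K` is a Betti splitting.  The convention `β_{-1,j} = 0` is in force. -/
structure IsBettiSplitting (I J K : Ideal (MvPolynomial (Fin n) k)) : Prop where
  isMonomialIdeal : IsMonomialIdeal I
  isMonomialIdeal_left : IsMonomialIdeal J
  isMonomialIdeal_right : IsMonomialIdeal K
  eq_sup : I = J ⊔ K
  minimalGenerators_eq : minimalGenerators I = minimalGenerators J ∪ minimalGenerators K
  disjoint : Disjoint (minimalGenerators J) (minimalGenerators K)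
  multigradedBetti_eq : ∀ (i : ℕ) (j : Fin n →₀ ℕ),
    multigradedBetti I i j = multigradedBetti J i j + multigradedBetti K i j +
      (if i = 0 then 0 else multigradedBetti (J ⊓ K) (i - 1) j)
  gradedBetti_eq : ∀ i d : ℕ,
    gradedBetti I i d = gradedBetti J i d + gradedBetti K i d +
      (if i = 0 then 0 else gradedBetti (J ⊓ K) (i - 1) d)

/-- `I = J + K` is an `x_v`-partition: `J` is generated by the elements of `𝒢(I)` divisible by
`x_v`, and `K` by the other elements of `𝒢(I)`. -/
structure IsVarPartition (v : Fin n) (I J K : Ideal (MvPolynomial (Fin n) k)) : Prop where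
  isMonomialIdeal : IsMonomialIdeal I
  left_eq : J = Ideal.span {m ∈ minimalGenerators I | MvPolynomial.X v ∣ m}
  right_eq : K = Ideal.span {m ∈ minimalGenerators I | ¬ MvPolynomial.X v ∣ m}

/-- `I = J + K` is an `x_v`-splitting: an `x_v`-partition that is a Betti splitting. -/
structure IsVarSplitting (v : Fin n) (I J K : Ideal (MvPolynomial (Fin n) k)) : Prop where
  isVarPartition : IsVarPartition v I J K
  isBettiSplitting : IsBettiSplitting I J K

end BettiNumbers

/-! ### Edge ideals -/

/-- The edge ideal `I(G) = (x_a x_b ∣ {x_a, x_b} ∈ E)`. -/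
noncomputable def edgeIdeal (k : Type u) [Field k] {n : ℕ} (G : SimpleGraph (Fin n)) :
    Ideal (MvPolynomial (Fin n) k) :=
  Ideal.span {m | ∃ a b, G.Adj a b ∧ m = MvPolynomial.X a * MvPolynomial.X b}

/-- `v` is a splitting vertex of `G`: it is not isolated, and `G \ {v}` is not a graph of isolated
vertices. -/
def IsSplittingVertex {n : ℕ} (G : SimpleGraph (Fin n)) (v : Fin n) : Prop :=
  ¬ G.IsIsolated v ∧ G.induce {v}ᶜ ≠ ⊥

/-! ### Projective resolutions spliced from syzygies -/

section Syzygies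

universe v w

variable {C : Type w} [Category.{v} C] [Abelian C]

/-! The exact sequence `0 ⟶ J ∩ K ⟶ J ⊕ K ⟶ J + K ⟶ 0` gives a long exact sequence of `Tor(k, -)_j`
in each multidegree `j`. The Betti numbers add up as claimed once every map `Tor_i(J ∩ K)_j ⟶
Tor_i(J)_j ⊕ Tor_i(K)_j` is zero (`multigradedBetti_sup`). For each of the two components, either
the source or the target vanishes. Component `J`: `J = x_v (x_b ∣ b ∈ N(v))` has a linear
resolution, so `Tor_i(J)_j = 0` for `|j| > 2 + i`. The generators of `J ∩ K` are lcms of two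
distinct edges, of degree at least 3, so `Tor_i(J ∩ K)_j = 0` for `|j| < 3 + i`. Component `K`: its
generators avoid `x_v`, so `Tor_i(K)_j = 0` unless `j_v = 0`. Every generator of `J ∩ K` is
divisible by `x_v`, so `Tor_i(J ∩ K)_j = 0` when `j_v = 0`. All these vanishing statements come from
one induction on the number of generators (`isZero_torIdeal_of_induction`), again by Mayer–Vietoris:
splitting off one monomial leaves a free module and an intersection generated by lcms. The long
exact sequence for left derived functors is obtained by iterating the horseshoe lemma. -/

/-- A sequence of short exact sequences `0 ⟶ Z (n + 1) ⟶ P n ⟶ Z n ⟶ 0`. -/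
structure SyzygySequence (C : Type w) [Category.{v} C] [Abelian C] where
  Z : ℕ → C
  P : ℕ → C
  p (n : ℕ) : P n ⟶ Z n
  ι (n : ℕ) : Z (n + 1) ⟶ P n
  ι_p (n : ℕ) : ι n ≫ p n = 0
  shortExact (n : ℕ) : (ShortComplex.mk (ι n) (p n) (ι_p n)).ShortExact

namespace SyzygySequence

/-- The chain complex `⋯ ⟶ P 1 ⟶ P 0`. -/
noncomputable abbrev complex (S : SyzygySequence C) : ChainComplex C ℕ :=
  ChainComplex.of S.P (fun n => S.p (n + 1) ≫ S.ι n) (fun n => by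
    simp [reassoc_of% (S.ι_p (n + 1))])

lemma complex_d (S : SyzygySequence C) (n : ℕ) :
    S.complex.d (n + 1) n = S.p (n + 1) ≫ S.ι n :=
  ChainComplex.of_d S.P (fun n => S.p (n + 1) ≫ S.ι n) n

/-- Precomposing `ι 0` with the epimorphism `p 1` does not change its image. -/
lemma exact_zero (S : SyzygySequence C) :
    (ShortComplex.mk (S.complex.d 1 0) (S.p 0) (by
      rw [S.complex_d, Category.assoc, S.ι_p, comp_zero])).Exact := by
  have h := (S.shortExact 0).exact
  have h1 : Epi (S.p 1) := (S.shortExact 1).epi_g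
  let α : ShortComplex.mk (S.complex.d 1 0) (S.p 0) (by
      rw [S.complex_d, Category.assoc, S.ι_p, comp_zero]) ⟶
      ShortComplex.mk (S.ι 0) (S.p 0) (S.ι_p 0) :=
    { τ₁ := S.p 1, τ₂ := 𝟙 _, τ₃ := 𝟙 _
      comm₁₂ := ((Category.comp_id _).trans (S.complex_d 0)).symm
      comm₂₃ := by simp }
  have : Epi α.τ₁ := h1
  have : IsIso α.τ₂ := inferInstanceAs (IsIso (𝟙 _))
  have : Mono α.τ₃ := inferInstanceAs (Mono (𝟙 _))
  exact (ShortComplex.exact_iff_of_epi_of_isIso_of_mono α).2 h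

/-- The epimorphism `p (n + 2)` does not affect the image of the incoming differential, nor the
monomorphism `ι n` the kernel of the outgoing one; what remains is the short exact sequence at `n +
1`. -/
lemma exactAt_succ (S : SyzygySequence C) (n : ℕ) : S.complex.ExactAt (n + 1) := by
  rw [HomologicalComplex.exactAt_iff' _ (n + 2) (n + 1) n (by simp) (by simp)]
  have h := (S.shortExact (n + 1)).exact
  have h1 : Epi (S.p (n + 2)) := (S.shortExact (n + 2)).epi_g
  have h2 : Mono (S.ι n) := (S.shortExact n).mono_f
  let α : S.complex.sc' (n + 2) (n + 1) n ⟶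
      ShortComplex.mk (S.ι (n + 1)) (S.p (n + 1) ≫ S.ι n) (by
        rw [reassoc_of% (S.ι_p (n + 1)), zero_comp]) :=
    { τ₁ := S.p (n + 2), τ₂ := 𝟙 _, τ₃ := 𝟙 _
      comm₁₂ := by
        change _ = S.complex.d (n + 2) (n + 1) ≫ _
        rw [S.complex_d]; erw [Category.comp_id]; rfl
      comm₂₃ := by
        change _ = S.complex.d (n + 1) n ≫ _
        rw [S.complex_d]; erw [Category.comp_id, Category.id_comp] }
  have : Epi α.τ₁ := h1
  have : IsIso α.τ₂ := inferInstanceAs (IsIso (𝟙 _))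
  have : Mono α.τ₃ := inferInstanceAs (Mono (𝟙 _))
  refine (ShortComplex.exact_iff_of_epi_of_isIso_of_mono α).2 ?_
  let β : ShortComplex.mk (S.ι (n + 1)) (S.p (n + 1)) (S.ι_p (n + 1)) ⟶
      ShortComplex.mk (S.ι (n + 1)) (S.p (n + 1) ≫ S.ι n) (by
        rw [reassoc_of% (S.ι_p (n + 1)), zero_comp]) :=
    { τ₁ := 𝟙 _, τ₂ := 𝟙 _, τ₃ := S.ι n
      comm₁₂ := by simp
      comm₂₃ := by simp }
  have : Epi β.τ₁ := inferInstanceAs (Epi (𝟙 _))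
  have : IsIso β.τ₂ := inferInstanceAs (IsIso (𝟙 _))
  have : Mono β.τ₃ := h2
  exact (ShortComplex.exact_iff_of_epi_of_isIso_of_mono β).1 h

lemma d_comp_p (S : SyzygySequence C) : S.complex.d 1 0 ≫ S.p 0 = 0 := by
  rw [S.complex_d, Category.assoc, S.ι_p, comp_zero]

/-- The projective resolution of `Z 0` spliced from the sequences
`0 ⟶ Z (n + 1) ⟶ P n ⟶ Z n ⟶ 0` with `P n` projective. -/
noncomputable def resolution (S : SyzygySequence C) (hP : ∀ n, Projective (S.P n)) :
    ProjectiveResolution (S.Z 0) where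
  complex := S.complex
  projective := hP
  π := (ChainComplex.toSingle₀Equiv _ _).symm ⟨S.p 0, S.d_comp_p⟩
  quasiIso := ⟨fun n => by
    cases n
    · rw [ChainComplex.quasiIsoAt₀_iff]
      refine (ShortComplex.quasiIso_iff_of_zeros' _ (by rfl) (by rfl) (by rfl)).2 ?_
      refine (ShortComplex.exact_and_epi_g_iff_of_iso ?_).2
        ⟨S.exact_zero, (S.shortExact 0).epi_g⟩
      refine ShortComplex.isoMk (Iso.refl _) (Iso.refl _) (Iso.refl _) ?_ ?_
      · erw [Category.id_comp, Category.comp_id]; rfl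
      · erw [Category.id_comp, Category.comp_id]
        exact (ChainComplex.toSingle₀Equiv_symm_apply_f_zero (C := S.complex) (S.p 0) S.d_comp_p).symm
    · rw [quasiIsoAt_iff_exactAt']
      · apply S.exactAt_succ
      · apply ChainComplex.exactAt_succ_single_obj⟩

lemma resolution_π_f_zero (S : SyzygySequence C) (hP : ∀ n, Projective (S.P n)) :
    (S.resolution hP).π.f 0 = S.p 0 :=
  ChainComplex.toSingle₀Equiv_symm_apply_f_zero (C := S.complex) (S.p 0) S.d_comp_p

/-- A morphism of sequences of syzygies. -/
structure Hom (S T : SyzygySequence C) where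
  z (n : ℕ) : S.Z n ⟶ T.Z n
  f (n : ℕ) : S.P n ⟶ T.P n
  p_z (n : ℕ) : S.p n ≫ z n = f n ≫ T.p n
  ι_f (n : ℕ) : S.ι n ≫ f n = z (n + 1) ≫ T.ι n

/-- The chain map induced by a morphism of sequences of syzygies. -/
noncomputable def Hom.map {S T : SyzygySequence C} (φ : Hom S T) : S.complex ⟶ T.complex :=
  ChainComplex.ofHom φ.f (fun n => by
    rw [complex_d, complex_d]
    simp only [Category.assoc]
    erw [φ.ι_f, ← Category.assoc, ← φ.p_z, Category.assoc])

end SyzygySequence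

end Syzygies

/-! ### The horseshoe lemma -/

section Horseshoe

universe v w

variable {C : Type w} [Category.{v} C] [Abelian C]

namespace CategoryTheory.ShortComplex

/-- The kernel of a morphism of short exact sequences with epimorphic components is short exact. -/
lemma shortExact_kernel {S T : ShortComplex C} (φ : S ⟶ T) (hS : S.ShortExact)
    (hT : T.ShortExact) (h₁ : Epi φ.τ₁) : (kernel φ).ShortExact := by
  have := hS.mono_f
  have := hS.epi_g
  have := hT.mono_f
  let D : SnakeInput C :=
    { L₀ := kernel φ, L₁ := S, L₂ := T, L₃ := cokernel φ
      v₀₁ := kernel.ι φ, v₁₂ := φ, v₂₃ := cokernel.π φ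
      h₀ := kernelIsKernel φ, h₃ := cokernelIsCokernel φ
      L₁_exact := hS.exact, epi_L₁_g := hS.epi_g
      L₂_exact := hT.exact, mono_L₂_f := hT.mono_f }
  -- Since `φ.τ₁` is epi, its cokernel is zero, so the connecting map of the snake lemma vanishes
  -- and the kernel sequence is exact on the right.
  have hz : D.v₂₃.τ₁ = 0 := by
    rw [← cancel_epi φ.τ₁, comp_zero]
    exact D.w₁₃_τ₁
  have hδ : D.δ = 0 := by
    have h : IsZero D.L₃.X₁ :=
      @IsZero.of_epi_eq_zero _ _ _ _ _ D.v₂₃.τ₁ (SnakeInput.epi_v₂₃_τ₁ D) hz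
    exact h.eq_of_tgt _ _
  have hm : Mono D.L₁.f := hS.mono_f
  exact ShortExact.mk' D.L₀_exact (SnakeInput.mono_L₀_f D)
    ((D.L₁'.exact_iff_epi hδ).1 D.L₁'_exact)

variable [EnoughProjectives C]

/-- A split short exact sequence of projectives mapping onto a given one. -/
noncomputable abbrev horseshoe (S : ShortComplex C) : ShortComplex C :=
  ShortComplex.mk (biprod.inl : Projective.over S.X₁ ⟶ Projective.over S.X₁ ⊞ Projective.over S.X₃)
    biprod.snd biprod.inl_snd

/-- The standard splitting of the horseshoe. -/
noncomputable def horseshoeSplitting (S : ShortComplex C) : (horseshoe S).Splitting where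
  r := biprod.fst
  s := biprod.inr
  id := biprod.total

lemma shortExact_horseshoe (S : ShortComplex C) : (horseshoe S).ShortExact :=
  (horseshoeSplitting S).shortExact

/-- The map from the horseshoe to a short exact sequence. -/
noncomputable abbrev horseshoeπ {S : ShortComplex C} (hS : S.ShortExact) : horseshoe S ⟶ S where
  τ₁ := Projective.π S.X₁
  τ₂ :=
    haveI := hS.epi_g
    biprod.desc (Projective.π S.X₁ ≫ S.f) (Projective.factorThru (Projective.π S.X₃) S.g)
  τ₃ := Projective.π S.X₃
  comm₁₂ := by simp
  comm₂₃ := by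
    have := hS.epi_g
    ext <;> simp

lemma epi_horseshoeπ_τ₂ {S : ShortComplex C} (hS : S.ShortExact) : Epi (horseshoeπ hS).τ₂ := by
  have := hS.epi_g
  exact epi_τ₂_of_exact_of_epi (horseshoeπ hS) hS.exact

end CategoryTheory.ShortComplex

end Horseshoe

/-! ### The long exact sequence of left derived functors -/

section LongExactSequence

universe v w v' w'

variable {C : Type w} [Category.{v} C] [Abelian C]

section Additive

variable [HasProjectiveResolutions C] {D : Type w'} [Category.{v'} D] [Abelian D]

/-- The sum of lifts of `f` and `g` to projective resolutions is a lift of `f + g`, and any lift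
computes the derived map. -/
instance CategoryTheory.Functor.leftDerived_additive (F : C ⥤ D) [F.Additive] (n : ℕ) :
    (F.leftDerived n).Additive where
  map_add {X Y f g} := by
    let P := projectiveResolution X
    let Q := projectiveResolution Y
    rw [F.leftDerived_map_eq n f (P := P) (Q := Q) (ProjectiveResolution.lift f P Q) (by simp),
      F.leftDerived_map_eq n g (P := P) (Q := Q) (ProjectiveResolution.lift g P Q) (by simp),
      F.leftDerived_map_eq n (f + g) (P := P) (Q := Q)
        (ProjectiveResolution.lift f P Q + ProjectiveResolution.lift g P Q)
        (by simp [Preadditive.add_comp, Functor.map_add])]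
    simp only [Functor.map_add, Preadditive.add_comp, Preadditive.comp_add]

end Additive

variable {D : Type w'} [Category.{v'} D] [Abelian D]

namespace CategoryTheory.ShortComplex

/-- A short exact sequence of chain complexes gives a long exact sequence of functors computing the
homology of its terms. -/
theorem ShortExact.exists_δ_of_iso_homology {S : ShortComplex C} {L : ℕ → C ⥤ D}
    [∀ n, (L n).PreservesZeroMorphisms]
    {T : ShortComplex (ChainComplex D ℕ)} (hT : T.ShortExact)
    (e₁ : ∀ n, (L n).obj S.X₁ ≅ T.X₁.homology n) (e₂ : ∀ n, (L n).obj S.X₂ ≅ T.X₂.homology n)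
    (e₃ : ∀ n, (L n).obj S.X₃ ≅ T.X₃.homology n)
    (hf : ∀ n, (L n).map S.f ≫ (e₂ n).hom = (e₁ n).hom ≫ HomologicalComplex.homologyMap T.f n)
    (hg : ∀ n, (L n).map S.g ≫ (e₃ n).hom = (e₂ n).hom ≫ HomologicalComplex.homologyMap T.g n) :
    (∀ n, (S.map (L n)).Exact) ∧
    Epi ((L 0).map S.g) ∧
    ∀ n, ∃ δ : (L (n + 1)).obj S.X₃ ⟶ (L n).obj S.X₁,
      (∃ w : (L (n + 1)).map S.g ≫ δ = 0, (ShortComplex.mk _ _ w).Exact) ∧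
      ∃ w : δ ≫ (L n).map S.f = 0, (ShortComplex.mk _ _ w).Exact := by
  refine ⟨fun n => ?_, ?_, fun n => ?_⟩
  · exact (ShortComplex.exact_iff_of_iso (ShortComplex.isoMk (e₁ n) (e₂ n) (e₃ n)
      (hf n).symm (hg n).symm)).2 (hT.homology_exact₂ n)
  · have := hT.epi_g
    have h : Epi (HomologicalComplex.homologyMap T.g 0) :=
      HomologicalComplex.epi_homologyMap_of_epi_of_not_rel _ 0 (by simp)
    have h1 : (L 0).map S.g = (e₂ 0).hom ≫
        HomologicalComplex.homologyMap T.g 0 ≫ (e₃ 0).inv := by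
      rw [← Category.assoc, Iso.eq_comp_inv]
      exact hg 0
    rw [h1]
    infer_instance
  · have hn : (ComplexShape.down ℕ).Rel (n + 1) n := rfl
    let δ := (e₃ (n + 1)).hom ≫ hT.δ (n + 1) n hn ≫ (e₁ n).inv
    have hδ : δ ≫ (e₁ n).hom = (e₃ (n + 1)).hom ≫ hT.δ (n + 1) n hn := by simp [δ]
    have w₁ : (L (n + 1)).map S.g ≫ δ = 0 := by
      rw [← cancel_mono (e₁ n).hom, Category.assoc, hδ, reassoc_of% (hg (n + 1)),
        zero_comp, hT.comp_δ, comp_zero]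
    have w₂ : δ ≫ (L n).map S.f = 0 := by
      rw [← cancel_mono (e₂ n).hom, Category.assoc, hf, reassoc_of% hδ, zero_comp, hT.δ_comp,
        comp_zero]
    refine ⟨δ, ⟨w₁, ?_⟩, ⟨w₂, ?_⟩⟩
    · exact (ShortComplex.exact_iff_of_iso (ShortComplex.isoMk (e₂ (n + 1))
        (e₃ (n + 1)) (e₁ n) (hg (n + 1)).symm hδ.symm)).2 (hT.homology_exact₃ (n + 1) n hn)
    · exact (ShortComplex.exact_iff_of_iso (ShortComplex.isoMk (e₃ (n + 1))
        (e₁ n) (e₂ n) hδ.symm (hf n).symm)).2 (hT.homology_exact₁ (n + 1) n hn)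

variable [EnoughProjectives C]

instance epi_horseshoeπ_τ₁ {S : ShortComplex C} (hS : S.ShortExact) : Epi (horseshoeπ hS).τ₁ :=
  inferInstanceAs (Epi (Projective.π S.X₁))

instance epi_horseshoeπ_τ₃ {S : ShortComplex C} (hS : S.ShortExact) : Epi (horseshoeπ hS).τ₃ :=
  inferInstanceAs (Epi (Projective.π S.X₃))

/-- The iterated kernels of the maps from the horseshoes. -/
noncomputable def syzygies {S : ShortComplex C} (hS : S.ShortExact) :
    ℕ → {T : ShortComplex C // T.ShortExact}
  | 0 => ⟨S, hS⟩
  | n + 1 => ⟨kernel (horseshoeπ (syzygies hS n).2),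
      shortExact_kernel _ (shortExact_horseshoe _) (syzygies hS n).2 (epi_horseshoeπ_τ₁ _)⟩

/-- The inclusion of a syzygy into the horseshoe. -/
noncomputable def syzygiesι {S : ShortComplex C} (hS : S.ShortExact) (n : ℕ) :
    (syzygies hS (n + 1)).1 ⟶ horseshoe (syzygies hS n).1 :=
  kernel.ι (horseshoeπ (syzygies hS n).2)

lemma syzygiesι_π {S : ShortComplex C} (hS : S.ShortExact) (n : ℕ) :
    syzygiesι hS n ≫ horseshoeπ (syzygies hS n).2 = 0 :=
  kernel.condition _

/-- The sequence of syzygies obtained by applying one of the projections `π₁`, `π₂`, `π₃` to the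
horseshoes. -/
noncomputable def syzygySequence {S : ShortComplex C} (hS : S.ShortExact) (G : ShortComplex C ⥤ C)
    [G.PreservesZeroMorphisms] [PreservesLimitsOfShape WalkingParallelPair G]
    (hG : ∀ {T : ShortComplex C} (hT : T.ShortExact), Epi (G.map (horseshoeπ hT))) :
    SyzygySequence C where
  Z n := G.obj (syzygies hS n).1
  P n := G.obj (horseshoe (syzygies hS n).1)
  p n := G.map (horseshoeπ (syzygies hS n).2)
  ι n := G.map (syzygiesι hS n)
  ι_p n := by rw [← G.map_comp, syzygiesι_π, G.map_zero]
  shortExact n := by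
    -- `G` preserves kernels, so the image of the kernel inclusion is still a kernel; the hypothesis
    -- on `G` supplies the epimorphism on the right.
    have h := isLimitForkMapOfIsLimit' G (kernel.condition _) (kernelIsKernel (horseshoeπ (syzygies hS n).2))
    exact @ShortExact.mk' _ _ _ (ShortComplex.mk _ _ _)
      (exact_of_f_is_kernel (ShortComplex.mk _ _ _) h) (mono_of_isLimit_fork h) (hG _)

/-- A natural transformation between projections induces a morphism of sequences of syzygies. -/
noncomputable def syzygySequenceHom {S : ShortComplex C} (hS : S.ShortExact)
    {G H : ShortComplex C ⥤ C}
    [G.PreservesZeroMorphisms] [PreservesLimitsOfShape WalkingParallelPair G]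
    [H.PreservesZeroMorphisms] [PreservesLimitsOfShape WalkingParallelPair H]
    (hG : ∀ {T : ShortComplex C} (hT : T.ShortExact), Epi (G.map (horseshoeπ hT)))
    (hH : ∀ {T : ShortComplex C} (hT : T.ShortExact), Epi (H.map (horseshoeπ hT)))
    (α : G ⟶ H) :
    SyzygySequence.Hom (syzygySequence hS G hG) (syzygySequence hS H hH) where
  z _ := α.app _
  f _ := α.app _
  p_z _ := α.naturality _
  ι_f _ := α.naturality _

variable (F : C ⥤ D) [F.Additive]

/-- The long exact sequence of the left derived functors of an additive functor. -/
theorem ShortExact.exists_leftDerived_δ {S : ShortComplex C} (hS : S.ShortExact) :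
    (∀ n, ((S.map (F.leftDerived n)).Exact)) ∧
    Epi ((F.leftDerived 0).map S.g) ∧
    ∀ n, ∃ δ : (F.leftDerived (n + 1)).obj S.X₃ ⟶ (F.leftDerived n).obj S.X₁,
      (∃ w : (F.leftDerived (n + 1)).map S.g ≫ δ = 0, (ShortComplex.mk _ _ w).Exact) ∧
      ∃ w : δ ≫ (F.leftDerived n).map S.f = 0, (ShortComplex.mk _ _ w).Exact := by
  -- The three projections of a single sequence of horseshoes yield compatible resolutions of the
  -- three terms.
  let A₁ := syzygySequence hS π₁ epi_horseshoeπ_τ₁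
  let A₂ := syzygySequence hS π₂ epi_horseshoeπ_τ₂
  let A₃ := syzygySequence hS π₃ epi_horseshoeπ_τ₃
  let a : SyzygySequence.Hom A₁ A₂ := syzygySequenceHom hS _ _ π₁Toπ₂
  let b : SyzygySequence.Hom A₂ A₃ := syzygySequenceHom hS _ _ π₂Toπ₃
  let P₁ : ProjectiveResolution S.X₁ := A₁.resolution fun n =>
    inferInstanceAs (Projective (Projective.over _))
  let P₂ : ProjectiveResolution S.X₂ := A₂.resolution fun n =>
    inferInstanceAs (Projective (Projective.over _ ⊞ Projective.over _))
  let P₃ : ProjectiveResolution S.X₃ := A₃.resolution fun n =>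
    inferInstanceAs (Projective (Projective.over _))
  have hab : a.map ≫ b.map = 0 := by
    ext n
    exact (horseshoe (syzygies hS n).1).zero
  let T : ShortComplex (ChainComplex D ℕ) := (ShortComplex.mk a.map b.map hab).map
    (F.mapHomologicalComplex _)
  -- The sequence of resolutions splits in each degree, so it stays short exact under `F`, which is
  -- only additive.
  have hT : T.ShortExact := HomologicalComplex.shortExact_of_degreewise_shortExact _ fun n =>
    ((horseshoeSplitting (syzygies hS n).1).map F).shortExact
  have ha : a.map.f 0 ≫ P₂.π.f 0 = P₁.π.f 0 ≫ S.f := by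
    erw [SyzygySequence.resolution_π_f_zero, SyzygySequence.resolution_π_f_zero]
    exact (a.p_z 0).symm
  have hb : b.map.f 0 ≫ P₃.π.f 0 = P₂.π.f 0 ≫ S.g := by
    erw [SyzygySequence.resolution_π_f_zero, SyzygySequence.resolution_π_f_zero]
    exact (b.p_z 0).symm
  exact exists_δ_of_iso_homology hT (fun n => P₁.isoLeftDerivedObj F n)
    (fun n => P₂.isoLeftDerivedObj F n) (fun n => P₃.isoLeftDerivedObj F n)
    (fun n => ProjectiveResolution.isoLeftDerivedObj_hom_naturality S.f P₁ P₂ a.map ha F n)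
    (fun n => ProjectiveResolution.isoLeftDerivedObj_hom_naturality S.g P₂ P₃ b.map hb F n)

end CategoryTheory.ShortComplex

end LongExactSequence

/-! ### Monomial ideals and the Mayer–Vietoris sequence -/

section MonomialIdeals

open MvPolynomial

variable {k : Type u} [Field k] {n : ℕ}

/-- The ideal generated by the monomials with exponents in `S`. -/
noncomputable def monomialIdeal (k : Type u) [Field k] {n : ℕ} (S : Set (Fin n →₀ ℕ)) :
    Ideal (MvPolynomial (Fin n) k) :=
  Ideal.span ((fun a => monomial a (1 : k)) '' S)

lemma mem_monomialIdeal {S : Set (Fin n →₀ ℕ)} {x : MvPolynomial (Fin n) k} :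
    x ∈ monomialIdeal k S ↔ ∀ a ∈ x.support, ∃ s ∈ S, s ≤ a :=
  mem_ideal_span_monomial_image

lemma monomial_mem_monomialIdeal {S : Set (Fin n →₀ ℕ)} {a : Fin n →₀ ℕ} {c : k} (hc : c ≠ 0) :
    monomial a c ∈ monomialIdeal k S ↔ ∃ s ∈ S, s ≤ a := by
  classical
  rw [mem_monomialIdeal, support_monomial, if_neg hc]
  simp

lemma monomialIdeal_union (S T : Set (Fin n →₀ ℕ)) :
    monomialIdeal k (S ∪ T) = monomialIdeal k S ⊔ monomialIdeal k T := by
  rw [monomialIdeal, Set.image_union, Ideal.span_union]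
  rfl

/-- A monomial is divisible by both `x^s` and `x^t` exactly when it is divisible by their lcm `x^(s
⊔ t)`. -/
lemma monomialIdeal_inf (S T : Set (Fin n →₀ ℕ)) :
    monomialIdeal k S ⊓ monomialIdeal k T = monomialIdeal k (Set.image2 (· ⊔ ·) S T) := by
  ext x
  simp only [Ideal.mem_inf, mem_monomialIdeal]
  constructor
  · rintro ⟨h1, h2⟩ a ha
    obtain ⟨s, hs, hsa⟩ := h1 a ha
    obtain ⟨t, ht, hta⟩ := h2 a ha
    exact ⟨s ⊔ t, ⟨s, hs, t, ht, rfl⟩, sup_le hsa hta⟩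
  · intro h
    constructor
    · intro a ha
      obtain ⟨_, ⟨s, hs, t, ht, rfl⟩, h⟩ := h a ha
      exact ⟨s, hs, le_sup_left.trans h⟩
    · intro a ha
      obtain ⟨_, ⟨s, hs, t, ht, rfl⟩, h⟩ := h a ha
      exact ⟨t, ht, le_sup_right.trans h⟩

lemma isMonomialIdeal_monomialIdeal (S : Set (Fin n →₀ ℕ)) :
    IsMonomialIdeal (monomialIdeal k S) :=
  ⟨S, rfl⟩

/-- The inclusion of ideals as a morphism of multigraded modules. -/
noncomputable def multigradedInclusion {I J : Ideal (MvPolynomial (Fin n) k)} (h : I ≤ J) :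
    multigradedIdeal I ⟶ multigradedIdeal J where
  app a := ModuleCat.ofHom (Submodule.inclusion
    (inf_le_inf_right (LinearMap.range (monomial a)) h : multidegreeComponent I a ≤ _))
  naturality _ _ _ := rfl

lemma MultigradedModule.congr_app {M N : MultigradedModule k n} {φ ψ : M ⟶ N} (h : φ = ψ)
    (a : Fin n →₀ ℕ) (x : M.obj a) : (φ.app a).hom x = (ψ.app a).hom x := by
  rw [h]

/-- A short complex of multigraded modules is exact if it is exact in every multidegree. -/
lemma exact_of_forall_exact_app (S : ShortComplex (MultigradedModule k n))
    (h : ∀ a, Function.Exact (S.f.app a).hom (S.g.app a).hom) : S.Exact := by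
  rw [ShortComplex.exact_iff_isZero_homology, Functor.isZero_iff]
  intro a
  have e := S.mapHomologyIso ((evaluation _ (ModuleCat.{u} k)).obj a)
  refine IsZero.of_iso ?_ e.symm
  rw [← ShortComplex.exact_iff_isZero_homology, ShortComplex.ShortExact.moduleCat_exact_iff_function_exact]
  exact h a

/-- The Mayer–Vietoris sequence `0 ⟶ I ∩ J ⟶ I ⊕ J ⟶ I + J ⟶ 0`. -/
noncomputable def mayerVietoris (I J : Ideal (MvPolynomial (Fin n) k)) :
    ShortComplex (MultigradedModule k n) :=
  ShortComplex.mk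
    (multigradedInclusion (inf_le_left : I ⊓ J ≤ I) ≫ biprod.inl +
      multigradedInclusion (inf_le_right : I ⊓ J ≤ J) ≫ biprod.inr)
    (biprod.desc (multigradedInclusion (le_sup_left : I ≤ I ⊔ J))
      (-multigradedInclusion (le_sup_right : J ≤ I ⊔ J)))
    (by simp [Preadditive.add_comp]; rw [add_neg_eq_zero]; rfl)

lemma mayerVietoris_f_comp_fst (I J : Ideal (MvPolynomial (Fin n) k)) :
    (mayerVietoris I J).f ≫ (biprod.fst : _ ⟶ multigradedIdeal I) =
      multigradedInclusion inf_le_left := by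
  simp [mayerVietoris, Preadditive.add_comp]

lemma mono_multigradedInclusion {I J : Ideal (MvPolynomial (Fin n) k)} (h : I ≤ J) :
    Mono (multigradedInclusion h) := by
  have : ∀ a, Mono ((multigradedInclusion h).app a) := fun a => by
    rw [ModuleCat.mono_iff_injective]
    exact fun x y hxy => Subtype.ext (congrArg (fun z : multidegreeComponent J a => z.1) hxy)
  exact NatTrans.mono_of_mono_app _

/-- Monomiality matters only for surjectivity: a monomial of `I + J` already lies in `I` or in `J`,
which fails for arbitrary ideals. -/
lemma shortExact_mayerVietoris {I J : Ideal (MvPolynomial (Fin n) k)} (hI : IsMonomialIdeal I)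
    (hJ : IsMonomialIdeal J) : (mayerVietoris I J).ShortExact := by
  refine ShortComplex.ShortExact.mk' (exact_of_forall_exact_app _ fun a => ?_) ?_ ?_
  · intro x
    constructor
    · intro hx
      let p : multidegreeComponent I a :=
        ((biprod.fst : multigradedIdeal I ⊞ multigradedIdeal J ⟶ _).app a).hom x
      let q : multidegreeComponent J a :=
        ((biprod.snd : multigradedIdeal I ⊞ multigradedIdeal J ⟶ _).app a).hom x
      have hxpq : x = ((biprod.inl : _ ⟶ multigradedIdeal I ⊞ multigradedIdeal J).app a).hom p +
          ((biprod.inr : _ ⟶ multigradedIdeal I ⊞ multigradedIdeal J).app a).hom q := by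
        exact (MultigradedModule.congr_app
          (biprod.total (X := multigradedIdeal I) (Y := multigradedIdeal J)) a x).symm
      have hpq : p.1 = q.1 := by
        have h1 : (mayerVietoris I J).g =
          biprod.fst ≫ multigradedInclusion (le_sup_left : I ≤ I ⊔ J) -
            biprod.snd ≫ multigradedInclusion (le_sup_right : J ≤ I ⊔ J) := by
          exact biprod.hom_ext' _ _ (by simp [mayerVietoris]) (by simp [mayerVietoris])
        rw [h1] at hx
        have h2 : p.1 - q.1 = 0 := congrArg Subtype.val hx
        exact sub_eq_zero.1 h2
      refine ⟨(⟨p.1, ⟨p.2.1, hpq ▸ q.2.1⟩, p.2.2⟩ : multidegreeComponent (I ⊓ J) a), ?_⟩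
      have hq : q = ⟨p.1, hpq ▸ q.2⟩ := Subtype.ext hpq.symm
      rw [hxpq]
      exact congrArg (fun z => ((biprod.inl : _ ⟶ multigradedIdeal I ⊞ multigradedIdeal J).app
        a).hom p + ((biprod.inr : _ ⟶ multigradedIdeal I ⊞ multigradedIdeal J).app a).hom z)
        hq.symm
    · rintro ⟨y, rfl⟩
      exact MultigradedModule.congr_app (mayerVietoris I J).zero a y
  · have : Mono ((mayerVietoris I J).f ≫ (biprod.fst : _ ⟶ multigradedIdeal I)) := by
      rw [mayerVietoris_f_comp_fst]
      exact mono_multigradedInclusion _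
    exact mono_of_mono _ (biprod.fst : _ ⟶ multigradedIdeal I)
  · have : ∀ a, Epi ((mayerVietoris I J).g.app a) := fun a => by
      rw [ModuleCat.epi_iff_surjective]
      rintro ⟨y, hy, c, rfl⟩
      obtain ⟨S, rfl⟩ := hI
      obtain ⟨T, rfl⟩ := hJ
      by_cases hc : c = 0
      · subst hc
        exact ⟨0, (map_zero _).trans (Subtype.ext (map_zero (monomial a)).symm)⟩
      have hy' : monomial a c ∈ monomialIdeal k (S ∪ T) := by
        rw [monomialIdeal_union]; exact hy
      obtain ⟨s, hs, hsa⟩ := (monomial_mem_monomialIdeal hc).1 hy'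
      rcases hs with hs | hs
      · refine ⟨((biprod.inl : _ ⟶ multigradedIdeal _ ⊞ multigradedIdeal _).app a).hom
          ⟨monomial a c, (monomial_mem_monomialIdeal hc).2 ⟨s, hs, hsa⟩, c, rfl⟩, ?_⟩
        exact MultigradedModule.congr_app (biprod.inl_desc _ _) a _
      · refine ⟨((biprod.inr : _ ⟶ multigradedIdeal _ ⊞ multigradedIdeal _).app a).hom
          ⟨-monomial a c, neg_mem ((monomial_mem_monomialIdeal hc).2 ⟨s, hs, hsa⟩), -c,
            map_neg _ _⟩, ?_⟩
        refine (MultigradedModule.congr_app (biprod.inr_desc _ _) a _).trans ?_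
        exact Subtype.ext (neg_neg (monomial a c))
    exact NatTrans.epi_of_epi_app _

end MonomialIdeals

/-! ### Vanishing of Tor for monomial ideals -/

section Vanishing

open MvPolynomial

variable {k : Type u} [Field k] {n : ℕ}

instance torResidueField.additive (i : ℕ) (j : Fin n →₀ ℕ) :
    (torResidueField k n i j).Additive :=
  inferInstanceAs ((tensorResidueField k n j).leftDerived i).Additive

/-- `Tor_i(k, I)_j`. -/
noncomputable abbrev torIdeal (I : Ideal (MvPolynomial (Fin n) k)) (i : ℕ) (j : Fin n →₀ ℕ) :
    ModuleCat.{u} k :=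
  (torResidueField k n i j).obj (multigradedIdeal I)

lemma CategoryTheory.Functor.isZero_obj_biprod {C D : Type*} [Category* C] [Category* D]
    [Preadditive C] [Preadditive D] (F : C ⥤ D) [F.Additive] {X Y : C} [HasBinaryBiproduct X Y]
    (hX : IsZero (F.obj X)) (hY : IsZero (F.obj Y)) : IsZero (F.obj (X ⊞ Y)) := by
  rw [IsZero.iff_id_eq_zero, ← F.map_id, ← biprod.total, F.map_add, F.map_comp, F.map_comp,
    hX.eq_of_tgt (F.map biprod.fst) 0, hY.eq_of_tgt (F.map biprod.snd) 0]
  simp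

lemma isZero_torIdeal_sup_zero {I J : Ideal (MvPolynomial (Fin n) k)} (hI : IsMonomialIdeal I)
    (hJ : IsMonomialIdeal J) {j : Fin n →₀ ℕ} (h1 : IsZero (torIdeal I 0 j))
    (h2 : IsZero (torIdeal J 0 j)) : IsZero (torIdeal (I ⊔ J) 0 j) := by
  have h := ((shortExact_mayerVietoris hI hJ).exists_leftDerived_δ (tensorResidueField k n j)).2.1
  have hz := (torResidueField k n 0 j).isZero_obj_biprod h1 h2
  exact @IsZero.of_epi _ _ _ _ _ (((tensorResidueField k n j).leftDerived 0).map
    (mayerVietoris I J).g) h hz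

/-- `Tor_{i+1}(I + J)_j` sits in the long exact sequence between `Tor_{i+1}(I)_j ⊕ Tor_{i+1}(J)_j`
and `Tor_i(I ∩ J)_j`. -/
lemma isZero_torIdeal_sup_succ {I J : Ideal (MvPolynomial (Fin n) k)} (hI : IsMonomialIdeal I)
    (hJ : IsMonomialIdeal J) {i : ℕ} {j : Fin n →₀ ℕ} (h1 : IsZero (torIdeal I (i + 1) j))
    (h2 : IsZero (torIdeal J (i + 1) j)) (h3 : IsZero (torIdeal (I ⊓ J) i j)) :
    IsZero (torIdeal (I ⊔ J) (i + 1) j) := by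
  obtain ⟨δ, ⟨w, hw⟩, -⟩ :=
    ((shortExact_mayerVietoris hI hJ).exists_leftDerived_δ (tensorResidueField k n j)).2.2 i
  have hz := (torResidueField k n (i + 1) j).isZero_obj_biprod h1 h2
  exact hw.isZero_of_both_zeros (hz.eq_of_src _ _) (h3.eq_of_tgt _ _)

lemma isZero_multigradedIdeal_bot :
    IsZero (multigradedIdeal (⊥ : Ideal (MvPolynomial (Fin n) k))) := by
  rw [Functor.isZero_iff]
  intro a
  have : Subsingleton (multidegreeComponent (⊥ : Ideal (MvPolynomial (Fin n) k)) a) :=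
    ⟨fun x y => Subtype.ext (((Submodule.mem_bot _).1 x.2.1).trans
      ((Submodule.mem_bot _).1 y.2.1).symm)⟩
  exact ModuleCat.isZero_of_subsingleton (ModuleCat.of k _)

lemma isZero_torIdeal_bot (i : ℕ) (j : Fin n →₀ ℕ) :
    IsZero (torIdeal (⊥ : Ideal (MvPolynomial (Fin n) k)) i j) :=
  (torResidueField k n i j).map_isZero isZero_multigradedIdeal_bot

/-! ### Principal monomial ideals as free modules of rank one -/

section Principal

variable (k) in
lemma subsingleton_multidegreeComponent_monomialIdeal {S : Set (Fin n →₀ ℕ)} {a : Fin n →₀ ℕ}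
    (h : ∀ s ∈ S, ¬ s ≤ a) : Subsingleton (multidegreeComponent (monomialIdeal k S) a) := by
  have h0 : ∀ x : multidegreeComponent (monomialIdeal k S) a, x.1 = 0 := by
    rintro ⟨_, hx, c, rfl⟩
    by_contra hc
    have hc : c ≠ 0 := fun h => hc (by simp [h])
    obtain ⟨s, hs, hsa⟩ := (monomial_mem_monomialIdeal hc).1 hx
    exact h s hs hsa
  exact ⟨fun x y => Subtype.ext ((h0 x).trans (h0 y).symm)⟩

variable (k) in
/-- The generator `x^m` of the principal ideal `(x^m)`. -/
noncomputable def principalGenerator (m : Fin n →₀ ℕ) :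
    (multigradedIdeal (monomialIdeal k {m})).obj m :=
  (⟨monomial m 1, (monomial_mem_monomialIdeal one_ne_zero).2 ⟨m, rfl, le_rfl⟩, 1, rfl⟩ :
    multidegreeComponent (monomialIdeal k {m}) m)

lemma eq_smul_map_principalGenerator {m a : Fin n →₀ ℕ} (h : m ≤ a)
    (x : multidegreeComponent (monomialIdeal k {m}) a) :
    x = coeff a x.1 • ((multigradedIdeal (monomialIdeal k {m})).map (homOfLE h)).hom
      (principalGenerator k m) := by
  obtain ⟨_, hx, c, rfl⟩ := x
  refine Subtype.ext ?_
  change monomial a c = coeff a (monomial a c) • (monomial (a - m) (1 : k) * monomial m 1)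
  rw [monomial_mul, tsub_add_cancel_of_le h, coeff_monomial, if_pos rfl, smul_monomial]
  simp

lemma coeff_monomial_tsub_mul {a b : Fin n →₀ ℕ} (h : a ≤ b) (p : MvPolynomial (Fin n) k) :
    coeff b (monomial (b - a) (1 : k) * p) = coeff a p := by
  have h1 := coeff_monomial_mul a (b - a) (1 : k) p
  rwa [one_mul, tsub_add_cancel_of_le h] at h1

/-- The map `(x^m) ⟶ N` which sends `x^m` to `y`. -/
noncomputable def principalDesc (m : Fin n →₀ ℕ) (N : MultigradedModule k n) (y : N.obj m) :
    multigradedIdeal (monomialIdeal k {m}) ⟶ N where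
  app a := ModuleCat.ofHom
    (if h : m ≤ a then (((lcoeff k a).comp (Submodule.subtype _)).smulRight
      ((N.map (homOfLE h)).hom y)) else 0)
  naturality a b f := by
    refine ModuleCat.hom_ext (LinearMap.ext fun x => ?_)
    by_cases h : m ≤ a
    · have h' : m ≤ b := h.trans (leOfHom f)
      rw [dif_pos h, dif_pos h']
      change coeff b (((multigradedIdeal _).map f).hom x : multidegreeComponent _ b).1 •
        (N.map (homOfLE h')).hom y = (N.map f).hom (coeff a (Subtype.val x) •
        (N.map (homOfLE h)).hom y)
      rw [map_smul, show homOfLE h' = homOfLE h ≫ f from rfl, N.map_comp]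
      exact congrArg (fun c : k => c • (N.map f).hom ((N.map (homOfLE h)).hom y))
        (coeff_monomial_tsub_mul (leOfHom f) (Subtype.val x))
    · have := subsingleton_multidegreeComponent_monomialIdeal k (S := {m}) (a := a) (by simpa)
      rw [Subsingleton.elim (α := multidegreeComponent (monomialIdeal k {m}) a) x 0]
      exact (map_zero _).trans (map_zero _).symm

lemma principalDesc_app {m a : Fin n →₀ ℕ} (N : MultigradedModule k n) (y : N.obj m) (h : m ≤ a)
    (x : multidegreeComponent (monomialIdeal k {m}) a) :
    ((principalDesc m N y).app a).hom x = coeff a x.1 • (N.map (homOfLE h)).hom y := by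
  simp only [principalDesc, dif_pos h]
  rfl

lemma app_principal {m a : Fin n →₀ ℕ} {N : MultigradedModule k n}
    (φ : multigradedIdeal (monomialIdeal k {m}) ⟶ N) (h : m ≤ a)
    (x : multidegreeComponent (monomialIdeal k {m}) a) :
    (φ.app a).hom x =
      coeff a x.1 • (N.map (homOfLE h)).hom ((φ.app m).hom (principalGenerator k m)) := by
  conv_lhs => rw [eq_smul_map_principalGenerator h x]
  rw [map_smul]
  congr 1
  exact LinearMap.congr_fun (congrArg ModuleCat.Hom.hom (φ.naturality (homOfLE h))) _

/-- `(x^m)` is free on `x^m`: a map out of it is determined by an arbitrary element of multidegree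
`m`, and that element lifts because epimorphisms are surjective in each multidegree. -/
lemma projective_multigradedIdeal_singleton (m : Fin n →₀ ℕ) :
    Projective (multigradedIdeal (monomialIdeal k {m})) := by
  refine ⟨fun {E X} f e he => ?_⟩
  have he' : Epi (e.app m) := inferInstance
  obtain ⟨y, hy⟩ := (ModuleCat.epi_iff_surjective _).1 he'
    ((f.app m).hom (principalGenerator k m))
  refine ⟨principalDesc m E y, ?_⟩
  ext a x
  by_cases h : m ≤ a
  · change (e.app a).hom (((principalDesc m E y).app a).hom x) = (f.app a).hom x
    refine Eq.trans ?_ (app_principal f h x).symm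
    refine (congrArg _ (principalDesc_app E y h x)).trans ?_
    rw [map_smul]
    congr 1
    refine (LinearMap.congr_fun (congrArg ModuleCat.Hom.hom (e.naturality (homOfLE h))) y).trans ?_
    exact congrArg (X.map (homOfLE h)).hom hy
  · have := subsingleton_multidegreeComponent_monomialIdeal k (S := {m}) (a := a) (by simpa)
    rw [Subsingleton.elim (α := multidegreeComponent (monomialIdeal k {m}) a) x 0]
    exact (map_zero _).trans (map_zero _).symm

lemma isIso_fromLeftDerivedZero_app (j : Fin n →₀ ℕ) (X : MultigradedModule k n) [Projective X] :
    IsIso ((tensorResidueField k n j).fromLeftDerivedZero.app X) :=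
  inferInstance

/-- In multidegree `j ≠ m`, either `x^m` does not divide `x^j` and the component is zero, or every
element is a proper monomial multiple of `x^m` and so lies in `𝔪 (x^m)`. -/
lemma isZero_tensorResidueField_singleton {m j : Fin n →₀ ℕ} (h : j ≠ m) :
    IsZero ((tensorResidueField k n j).obj (multigradedIdeal (monomialIdeal k {m}))) := by
  have htop : (multigradedIdeal (monomialIdeal k {m})).maximalIdealSMul j = ⊤ := by
    rw [eq_top_iff]
    intro x _
    by_cases hj : m ≤ j
    · refine Submodule.mem_iSup_of_mem m (Submodule.mem_iSup_of_mem (lt_of_le_of_ne hj h.symm) ?_)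
      rw [eq_smul_map_principalGenerator hj x, ← map_smul]
      exact ⟨_, rfl⟩
    · have := subsingleton_multidegreeComponent_monomialIdeal k (S := {m}) (a := j) (by simpa)
      rw [Subsingleton.elim (α := multidegreeComponent (monomialIdeal k {m}) j) x 0]
      exact zero_mem _
  have : Subsingleton ((multigradedIdeal (monomialIdeal k {m})).obj j ⧸
      (multigradedIdeal (monomialIdeal k {m})).maximalIdealSMul j) :=
    Submodule.Quotient.subsingleton_iff.2 htop
  exact ModuleCat.isZero_of_subsingleton (ModuleCat.of k _)

lemma isZero_torIdeal_singleton_zero {m j : Fin n →₀ ℕ} (h : j ≠ m) :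
    IsZero (torIdeal (monomialIdeal k {m}) 0 j) := by
  have := projective_multigradedIdeal_singleton (k := k) m
  have := isIso_fromLeftDerivedZero_app j (multigradedIdeal (monomialIdeal k {m}))
  exact IsZero.of_iso (isZero_tensorResidueField_singleton h)
    (@asIso _ _ _ _ ((tensorResidueField k n j).fromLeftDerivedZero.app
      (multigradedIdeal (monomialIdeal k {m}))) this)

lemma isZero_torIdeal_singleton_succ (m j : Fin n →₀ ℕ) (i : ℕ) :
    IsZero (torIdeal (monomialIdeal k {m}) (i + 1) j) := by
  have := projective_multigradedIdeal_singleton (k := k) m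
  exact (tensorResidueField k n j).isZero_leftDerived_obj_projective_succ i _

end Principal

/-- Vanishing of `Tor` by induction on the number of monomial generators. -/
theorem isZero_torIdeal_of_induction [DecidableEq (Fin n →₀ ℕ)] (j : Fin n →₀ ℕ)
    (H : ℕ → Finset (Fin n →₀ ℕ) → Prop)
    (h_singleton : ∀ m, H 0 {m} → j ≠ m)
    (h_insert : ∀ i m S, m ∉ S → H i (insert m S) → H i S ∧ H i {m})
    (h_sup : ∀ i m S, m ∉ S → H (i + 1) (insert m S) → H i (S.image (· ⊔ m)))
    (i : ℕ) (S : Finset (Fin n →₀ ℕ)) (hS : H i S) :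
    IsZero (torIdeal (monomialIdeal k (S : Set (Fin n →₀ ℕ))) i j) := by
  induction hc : S.card using Nat.strong_induction_on generalizing S i with
  | _ c ih =>
    rcases S.eq_empty_or_nonempty with rfl | ⟨m, hm⟩
    · simpa [monomialIdeal] using isZero_torIdeal_bot (k := k) i j
    -- Split off one generator `x^m`. The intersection of `(x^m)` with the rest is generated by the
    -- lcms `t ⊔ m`, at most `|T|` of them, and it enters with homological degree lowered by one.
    · obtain ⟨T, hmT, rfl⟩ : ∃ T, m ∉ T ∧ S = insert m T :=
        ⟨S.erase m, S.notMem_erase m, (Finset.insert_erase hm).symm⟩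
      rw [Finset.card_insert_of_notMem hmT] at hc
      obtain ⟨h1, h2⟩ := h_insert i m T hmT hS
      have hT := ih _ (by omega) i T h1 rfl
      rw [Finset.coe_insert, ← Set.union_singleton, monomialIdeal_union]
      cases i with
      | zero =>
        exact isZero_torIdeal_sup_zero (isMonomialIdeal_monomialIdeal _)
          (isMonomialIdeal_monomialIdeal _) hT
          (isZero_torIdeal_singleton_zero (h_singleton m h2))
      | succ i =>
        refine isZero_torIdeal_sup_succ (isMonomialIdeal_monomialIdeal _)
          (isMonomialIdeal_monomialIdeal _) hT (isZero_torIdeal_singleton_succ m j i) ?_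
        have h3 := ih _ (by have := T.card_image_le (f := (· ⊔ m)); omega) i _
          (h_sup i m T hmT hS) rfl
        rwa [monomialIdeal_inf, Set.image2_singleton_right, ← Finset.coe_image]

/-- If no generator of `I` divides `x^j`, then `Tor_i(k, I)_j = 0`. -/
lemma isZero_torIdeal_of_not_le {S : Finset (Fin n →₀ ℕ)} {j : Fin n →₀ ℕ}
    (h : ∀ s ∈ S, ¬ s ≤ j) (i : ℕ) :
    IsZero (torIdeal (monomialIdeal k (S : Set (Fin n →₀ ℕ))) i j) := by
  classical
  refine isZero_torIdeal_of_induction j (fun _ S => ∀ s ∈ S, ¬ s ≤ j) ?_ ?_ ?_ i S h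
  · rintro m h rfl
    exact h j (Finset.mem_singleton_self j) le_rfl
  · intro _ m S _ h
    simp only [Finset.mem_insert, forall_eq_or_imp] at h
    exact ⟨h.2, by simpa using h.1⟩
  · intro _ m S _ h
    simp only [Finset.mem_insert, forall_eq_or_imp] at h
    simp only [Finset.mem_image, forall_exists_index, and_imp, forall_apply_eq_imp_iff₂, sup_le_iff]
    exact fun _ _ h' => h.1 h'.2

/-- If the generators of `I` do not involve `x_v` and `j_v ≠ 0`, then `Tor_i(k, I)_j = 0`. -/
lemma isZero_torIdeal_of_apply_eq_zero {S : Finset (Fin n →₀ ℕ)} {v : Fin n}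
    (h : ∀ s ∈ S, s v = 0) {j : Fin n →₀ ℕ} (hj : j v ≠ 0) (i : ℕ) :
    IsZero (torIdeal (monomialIdeal k (S : Set (Fin n →₀ ℕ))) i j) := by
  classical
  refine isZero_torIdeal_of_induction j (fun _ S => ∀ s ∈ S, s v = 0) ?_ ?_ ?_ i S h
  · rintro m h rfl
    exact hj (h j (Finset.mem_singleton_self j))
  · intro _ m S _ h
    simp only [Finset.mem_insert, forall_eq_or_imp] at h
    exact ⟨h.2, by simpa using h.1⟩
  · intro _ m S _ h
    simp only [Finset.mem_insert, forall_eq_or_imp] at h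
    simp only [Finset.mem_image, forall_exists_index, and_imp, forall_apply_eq_imp_iff₂]
    intro s hs
    simp [h.1, h.2 s hs]

lemma Finsupp.eq_of_le_of_degree_le {σ : Type*} {s t : σ →₀ ℕ} (h : s ≤ t)
    (hd : t.degree ≤ s.degree) : s = t := by
  have h1 : (t - s).degree + s.degree = t.degree := by
    rw [← map_add, tsub_add_cancel_of_le h]
  have h2 : t - s = 0 := (Finsupp.degree_eq_zero_iff _).1 (by omega)
  exact le_antisymm h (tsub_eq_zero_iff_le.1 h2)

/-- If `I` is generated in degrees at least `d`, then `Tor_i(k, I)_j = 0` for `|j| < d + i`. -/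
lemma isZero_torIdeal_of_degree_lt {S : Finset (Fin n →₀ ℕ)} {d : ℕ}
    (h : ∀ s ∈ S, d ≤ s.degree) {i : ℕ} {j : Fin n →₀ ℕ} (hj : j.degree < d + i) :
    IsZero (torIdeal (monomialIdeal k (S : Set (Fin n →₀ ℕ))) i j) := by
  classical
  -- The bound `d` is quantified inside the predicate because it rises by one whenever `i` drops by
  -- one.
  refine isZero_torIdeal_of_induction j
    (fun i S => ∃ d, (∀ s ∈ S, d ≤ s.degree) ∧ j.degree < d + i) ?_ ?_ ?_ i S ⟨d, h, hj⟩
  · rintro m ⟨d, h, hd⟩ rfl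
    have := h j (Finset.mem_singleton_self j)
    omega
  · rintro i m S _ ⟨d, h, hd⟩
    simp only [Finset.mem_insert, forall_eq_or_imp] at h
    exact ⟨⟨d, h.2, hd⟩, ⟨d, by simpa using h.1, hd⟩⟩
  · rintro i m S hm ⟨d, h, hd⟩
    simp only [Finset.mem_insert, forall_eq_or_imp] at h
    -- Two distinct monomials of degree at least `d` have an lcm of degree at least `d + 1`;
    -- otherwise both would equal their lcm.
    refine ⟨d + 1, ?_, by omega⟩
    simp only [Finset.mem_image, forall_exists_index, and_imp, forall_apply_eq_imp_iff₂]
    intro s hs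
    by_contra hlt
    have h1 : s.degree ≤ (s ⊔ m).degree := Finsupp.degree_mono le_sup_left
    have h2 : m.degree ≤ (s ⊔ m).degree := Finsupp.degree_mono le_sup_right
    have hds := h.2 s hs
    have hs' : s = s ⊔ m := Finsupp.eq_of_le_of_degree_le le_sup_left (by omega)
    have hm' : m = s ⊔ m := Finsupp.eq_of_le_of_degree_le le_sup_right (by omega)
    exact hm (hm'.trans hs'.symm ▸ hs)

/-- The ideal `x^m (x_b ∣ b ∈ B)` has a linear resolution: `Tor_i(k, I)_j = 0` for
`|j| > |m| + 1 + i`. -/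
lemma isZero_torIdeal_of_lt_degree [DecidableEq (Fin n →₀ ℕ)] (m : Fin n →₀ ℕ) (B : Finset (Fin n)) {i : ℕ}
    {j : Fin n →₀ ℕ} (hj : m.degree + 1 + i < j.degree) :
    IsZero (torIdeal (monomialIdeal k ((B.image fun b => m + Finsupp.single b 1 :
      Finset (Fin n →₀ ℕ)) : Set (Fin n →₀ ℕ))) i j) := by
  refine isZero_torIdeal_of_induction j
    (fun i S => ∃ (m : Fin n →₀ ℕ) (B : Finset (Fin n)), S = B.image (fun b => m + Finsupp.single b 1) ∧
      m.degree + 1 + i < j.degree) ?_ ?_ ?_ i _ ⟨m, B, rfl, hj⟩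
  · rintro m' ⟨m, B, h, hd⟩ rfl
    obtain ⟨b, _, rfl⟩ := Finset.mem_image.1 (h ▸ Finset.mem_singleton_self j)
    simp at hd
  · rintro i m' S hm' ⟨m, B, h, hd⟩
    have hS : ∃ B' ⊆ B, S = B'.image (fun b => m + Finsupp.single b 1) :=
      Finset.subset_image_iff.1 (h ▸ Finset.subset_insert m' S) |>.imp fun _ h => ⟨h.1, h.2.symm⟩
    obtain ⟨B', -, rfl⟩ := hS
    obtain ⟨c, -, rfl⟩ := Finset.mem_image.1 (h ▸ Finset.mem_insert_self m' _)
    exact ⟨⟨m, B', rfl, hd⟩, ⟨m, {c}, by simp, hd⟩⟩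
  · rintro i m' S hm' ⟨m, B, h, hd⟩
    obtain ⟨B', -, rfl⟩ := Finset.subset_image_iff.1 (h ▸ Finset.subset_insert m' S)
    obtain ⟨c, -, rfl⟩ := Finset.mem_image.1 (h ▸ Finset.mem_insert_self m' _)
    -- For `b ≠ c`, the lcm of `x^m x_b` and `x^m x_c` is `(x^m x_c) x_b`, so the intersection has
    -- the same shape with `x^m` replaced by `x^m x_c`.
    refine ⟨m + Finsupp.single c 1, B', ?_, by simp; omega⟩
    rw [Finset.image_image]
    refine Finset.image_congr fun b hb => ?_
    have hbc : b ≠ c := fun hbc => hm' (hbc ▸ Finset.mem_image_of_mem _ hb)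
    ext x
    by_cases hxb : x = b
    · subst hxb
      simp [hbc]
    · simp [Ne.symm hxb]

end Vanishing

/-! ### Additivity of Betti numbers from vanishing maps on Tor -/

section BettiMayerVietoris

open MvPolynomial

variable {k : Type u} [Field k] {n : ℕ}

lemma CategoryTheory.Functor.rank_obj_biprod {C : Type*} [Category* C] [Preadditive C]
    (F : C ⥤ ModuleCat.{u} k) [F.Additive] (X Y : C) [HasBinaryBiproduct X Y] :
    Module.rank k (F.obj (X ⊞ Y)) = Module.rank k (F.obj X) + Module.rank k (F.obj Y) := by
  let e : F.obj (X ⊞ Y) ≅ F.obj X ⊞ F.obj Y :=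
    have := preservesBinaryBiproducts_of_preservesBiproducts F
    F.mapBiprod X Y
  rw [(e ≪≫ ModuleCat.biprodIsoProd _ _).toLinearEquiv.rank_eq]
  exact rank_prod'

lemma CategoryTheory.Functor.map_add_comp_eq_zero {C D : Type*} [Category* C] [Category* D]
    [Preadditive C] [Preadditive D] (F : C ⥤ D) [F.Additive] {X Y Z W : C} {a : X ⟶ Y} {b : X ⟶ Z}
    (ha : F.map a = 0) (hb : F.map b = 0) (p : Y ⟶ W) (q : Z ⟶ W) :
    F.map (a ≫ p + b ≫ q) = 0 := by
  simp [F.map_add, ha, hb]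

/-- If `Tor_i(k, I ∩ J)_j ⟶ Tor_i(k, I)_j ⊕ Tor_i(k, J)_j` vanishes for all `i` because one of the
sides of each component does, then the Betti numbers add up. -/
lemma multigradedBetti_sup {I J : Ideal (MvPolynomial (Fin n) k)} (hI : IsMonomialIdeal I)
    (hJ : IsMonomialIdeal J) (j : Fin n →₀ ℕ)
    (h1 : ∀ i, IsZero (torIdeal (I ⊓ J) i j) ∨ IsZero (torIdeal I i j))
    (h2 : ∀ i, IsZero (torIdeal (I ⊓ J) i j) ∨ IsZero (torIdeal J i j)) (i : ℕ) :
    multigradedBetti (I ⊔ J) i j = multigradedBetti I i j + multigradedBetti J i j +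
      (if i = 0 then 0 else multigradedBetti (I ⊓ J) (i - 1) j) := by
  obtain ⟨hex, hepi, hδ⟩ :=
    (shortExact_mayerVietoris hI hJ).exists_leftDerived_δ (tensorResidueField k n j)
  have hf (i : ℕ) : (torResidueField k n i j).map (mayerVietoris I J).f = 0 := by
    have ha : (torResidueField k n i j).map
        (multigradedInclusion (inf_le_left : I ⊓ J ≤ I)) = 0 :=
      (h1 i).elim (fun h => h.eq_of_src _ _) (fun h => h.eq_of_tgt _ _)
    have hb : (torResidueField k n i j).map
        (multigradedInclusion (inf_le_right : I ⊓ J ≤ J)) = 0 :=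
      (h2 i).elim (fun h => h.eq_of_src _ _) (fun h => h.eq_of_tgt _ _)
    exact (torResidueField k n i j).map_add_comp_eq_zero ha hb biprod.inl biprod.inr
  have hmid (i : ℕ) : Module.rank k ((torResidueField k n i j).obj (mayerVietoris I J).X₂) =
      multigradedBetti I i j + multigradedBetti J i j :=
    (torResidueField k n i j).rank_obj_biprod _ _
  have hmono (i : ℕ) : Function.Injective
      ((torResidueField k n i j).map (mayerVietoris I J).g).hom := by
    have := (ShortComplex.exact_iff_mono _ (hf i)).1 (hex i)
    exact (ModuleCat.mono_iff_injective _).1 this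
  rw [← hmid]
  cases i with
  | zero =>
    have hsurj : Function.Surjective
      ((torResidueField k n 0 j).map (mayerVietoris I J).g).hom :=
      (ModuleCat.epi_iff_surjective _).1 hepi
    rw [if_pos rfl, add_zero]
    exact (LinearEquiv.ofBijective _ ⟨hmono 0, hsurj⟩).rank_eq.symm
  | succ i =>
    obtain ⟨δ, ⟨w, hw⟩, ⟨w', hw'⟩⟩ := hδ i
    rw [if_neg i.succ_ne_zero, Nat.add_sub_cancel]
    have hδs : Function.Surjective δ.hom :=
      (ModuleCat.epi_iff_surjective _).1 ((ShortComplex.exact_iff_epi _ (hf i)).1 hw')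
    have hker := (ShortComplex.moduleCat_exact_iff_range_eq_ker _).1 hw
    -- Rank–nullity for `δ`: it is onto `Tor_i(I ∩ J)_j`, and its kernel is the injective image of
    -- `Tor_{i+1}(I)_j ⊕ Tor_{i+1}(J)_j`.
    have h := LinearMap.rank_range_add_rank_ker δ.hom
    rw [LinearMap.range_eq_top.2 hδs, rank_top] at h
    refine h.symm.trans ?_
    rw [add_comm]
    congr 1
    refine (congrArg (fun V : Submodule k _ => Module.rank k V) hker).symm.trans ?_
    exact (LinearEquiv.ofInjective _ (hmono (i + 1))).rank_eq.symm

end BettiMayerVietoris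

/-! ### Edge ideals: the star of a vertex and its deletion -/

section EdgeIdeals

open MvPolynomial

variable {k : Type u} [Field k] {n : ℕ}

/-- The minimal generators of a monomial ideal generated in a single degree. -/
lemma minimalGenerators_monomialIdeal {S : Set (Fin n →₀ ℕ)} {d : ℕ} (hS : ∀ s ∈ S, s.degree = d) :
    minimalGenerators (monomialIdeal k S) = (fun a => monomial a (1 : k)) '' S := by
  ext m
  constructor
  · rintro ⟨⟨a, rfl⟩, ha, hmin⟩
    obtain ⟨s, hs, hsa⟩ := (monomial_mem_monomialIdeal one_ne_zero).1 ha
    exact ⟨s, hs, hmin s ((monomial_mem_monomialIdeal one_ne_zero).2 ⟨s, hs, le_rfl⟩)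
      (monomial_dvd_monomial.2 ⟨Or.inr hsa, one_dvd _⟩)⟩
  · rintro ⟨s, hs, rfl⟩
    refine ⟨⟨s, rfl⟩, (monomial_mem_monomialIdeal one_ne_zero).2 ⟨s, hs, le_rfl⟩, fun b hb hbs => ?_⟩
    obtain ⟨t, ht, htb⟩ := (monomial_mem_monomialIdeal one_ne_zero).1 hb
    have hbs : b ≤ s := (monomial_dvd_monomial.1 hbs).1.resolve_left one_ne_zero
    have h := (hS t ht).trans (hS s hs).symm
    have h1 := Finsupp.degree_mono htb
    rw [Finsupp.eq_of_le_of_degree_le hbs (by omega)]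

/-- The exponents of the generators of the edge ideal. -/
def edgeExponents (G : SimpleGraph (Fin n)) : Set (Fin n →₀ ℕ) :=
  {e | ∃ a b, G.Adj a b ∧ e = Finsupp.single a 1 + Finsupp.single b 1}

lemma edgeIdeal_eq_monomialIdeal (G : SimpleGraph (Fin n)) :
    edgeIdeal k G = monomialIdeal k (edgeExponents G) := by
  rw [edgeIdeal, monomialIdeal]
  congr 1
  ext m
  constructor
  · rintro ⟨a, b, h, rfl⟩
    exact ⟨_, ⟨a, b, h, rfl⟩, by simp [X, monomial_mul]⟩
  · rintro ⟨_, ⟨a, b, h, rfl⟩, rfl⟩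
    exact ⟨a, b, h, by simp [X, monomial_mul]⟩

lemma degree_of_mem_edgeExponents {G : SimpleGraph (Fin n)} {e : Fin n →₀ ℕ}
    (he : e ∈ edgeExponents G) : e.degree = 2 := by
  obtain ⟨a, b, -, rfl⟩ := he
  simp

lemma finite_edgeExponents (G : SimpleGraph (Fin n)) : (edgeExponents G).Finite :=
  (Finsupp.finite_of_degree_eq 2).subset fun _ => degree_of_mem_edgeExponents

/-- Puts `J` in the form `x_v (x_b ∣ b ∈ N(v))`, to which the linear resolution bound applies. -/
lemma edgeExponents_star (G : SimpleGraph (Fin n)) (v : Fin n) :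
    {e ∈ edgeExponents G | e v ≠ 0} =
      (fun b => Finsupp.single v 1 + Finsupp.single b 1) '' G.neighborSet v := by
  ext e
  constructor
  · rintro ⟨⟨a, b, h, rfl⟩, hv⟩
    by_cases hav : a = v
    · exact ⟨b, hav ▸ h, by simp [hav]⟩
    · by_cases hbv : b = v
      · exact ⟨a, hbv ▸ h.symm, by simp [hbv, add_comm]⟩
      · simp [hav, hbv] at hv
  · rintro ⟨b, hb, rfl⟩
    exact ⟨⟨v, b, hb, rfl⟩, by simp⟩

lemma isZero_torIdeal_star (G : SimpleGraph (Fin n)) (v : Fin n) {i : ℕ} {j : Fin n →₀ ℕ}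
    (hj : 2 + i < j.degree) :
    IsZero (torIdeal (monomialIdeal k {e ∈ edgeExponents G | e v ≠ 0}) i j) := by
  classical
  have h := isZero_torIdeal_of_lt_degree (k := k) (Finsupp.single v 1)
    (G.neighborSet v).toFinite.toFinset (i := i) (j := j) (by simpa using hj)
  rwa [Finset.coe_image, Set.Finite.coe_toFinset, ← edgeExponents_star] at h

/-- The two vanishing ranges `|j| < 3 + i` for `J ∩ K` and `|j| > 2 + i` for `J` together cover
every degree. -/
lemma isZero_torIdeal_inf_or_star (G : SimpleGraph (Fin n)) (v : Fin n) (i : ℕ) (j : Fin n →₀ ℕ) :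
    IsZero (torIdeal (monomialIdeal k {e ∈ edgeExponents G | e v ≠ 0} ⊓
      monomialIdeal k {e ∈ edgeExponents G | e v = 0}) i j) ∨
    IsZero (torIdeal (monomialIdeal k {e ∈ edgeExponents G | e v ≠ 0}) i j) := by
  by_cases hj : 2 + i < j.degree
  · exact Or.inr (isZero_torIdeal_star G v hj)
  left
  have hfin := Set.Finite.image2 (· ⊔ ·) ((finite_edgeExponents G).subset (Set.sep_subset _ _))
    ((finite_edgeExponents G).subset (Set.sep_subset _ _)) (s := {e ∈ edgeExponents G | e v ≠ 0})
    (t := {e ∈ edgeExponents G | e v = 0})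
  have h := isZero_torIdeal_of_degree_lt (k := k) (S := hfin.toFinset) (d := 3) ?_ (i := i)
    (j := j) (by omega)
  · rwa [Set.Finite.coe_toFinset, ← monomialIdeal_inf] at h
  · intro e he
    obtain ⟨s, hs, t, ht, rfl⟩ := hfin.mem_toFinset.1 he
    by_contra hlt
    have hs2 := degree_of_mem_edgeExponents hs.1
    have ht2 := degree_of_mem_edgeExponents ht.1
    dsimp only at hlt
    have hs' := Finsupp.eq_of_le_of_degree_le (le_sup_left : s ≤ s ⊔ t) (by omega)
    have ht' := Finsupp.eq_of_le_of_degree_le (le_sup_right : t ≤ s ⊔ t) (by omega)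
    -- An lcm of degree 2 would force the two edges to coincide, but only one of them contains `v`.
    exact hs.2 (hs'.trans ht'.symm ▸ ht.2)

/-- The exponent `j v` decides: if it is zero, no generator of `J ∩ K` divides `x^j`; if not, `K`
has no Tor in multidegree `j`, since its generators avoid `x_v`. -/
lemma isZero_torIdeal_inf_or_deletion (G : SimpleGraph (Fin n)) (v : Fin n) (i : ℕ)
    (j : Fin n →₀ ℕ) :
    IsZero (torIdeal (monomialIdeal k {e ∈ edgeExponents G | e v ≠ 0} ⊓
      monomialIdeal k {e ∈ edgeExponents G | e v = 0}) i j) ∨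
    IsZero (torIdeal (monomialIdeal k {e ∈ edgeExponents G | e v = 0}) i j) := by
  have hK := (finite_edgeExponents G).subset (Set.sep_subset _ fun e => e v = 0)
  by_cases hj : j v = 0
  · left
    have hfin := Set.Finite.image2 (· ⊔ ·)
      ((finite_edgeExponents G).subset (Set.sep_subset _ fun e => e v ≠ 0)) hK
    have h := isZero_torIdeal_of_not_le (k := k) (S := hfin.toFinset) (j := j) ?_ i
    · rwa [Set.Finite.coe_toFinset, ← monomialIdeal_inf] at h
    · intro e he hej
      obtain ⟨s, hs, t, ht, rfl⟩ := hfin.mem_toFinset.1 he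
      have h1 : s v ≤ j v := (le_sup_left.trans hej) v
      exact hs.2 (by omega)
  · right
    have h := isZero_torIdeal_of_apply_eq_zero (k := k) (S := hK.toFinset) (v := v)
      (fun s hs => (hK.mem_toFinset.1 hs).2) hj i
    rwa [Set.Finite.coe_toFinset] at h

end EdgeIdeals

/-- The edge ideal of a simple graph with a splitting vertex `x_v` has an `x_v`-splitting. -/
theorem corollary3p1 (k : Type u) [Field k] (n : ℕ) (G : SimpleGraph (Fin n)) (v : Fin n)
    (hv : IsSplittingVertex G v) (J K : Ideal (MvPolynomial (Fin n) k))
    (hJ : J = Ideal.span {m ∈ minimalGenerators (edgeIdeal k G) | MvPolynomial.X v ∣ m})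
    (hK : K = Ideal.span (minimalGenerators (edgeIdeal k G) \ minimalGenerators J)) :
    IsVarSplitting v (edgeIdeal k G) J K := by
  -- All generators have degree 2, so none is redundant; the same holds for `J` and `K`, and all
  -- three sets of minimal generators are read off from exponents.
  have hE : minimalGenerators (edgeIdeal k G) =
      (fun a => MvPolynomial.monomial a (1 : k)) '' edgeExponents G := by
    rw [edgeIdeal_eq_monomialIdeal,
      minimalGenerators_monomialIdeal fun _ => degree_of_mem_edgeExponents]
  have hX (a : Fin n →₀ ℕ) : MvPolynomial.X v ∣ MvPolynomial.monomial a (1 : k) ↔ a v ≠ 0 := by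
    rw [MvPolynomial.X_dvd_monomial]
    simp
  have hinj : Function.Injective fun a : Fin n →₀ ℕ => MvPolynomial.monomial a (1 : k) :=
    MvPolynomial.monomial_left_injective one_ne_zero
  have hstar : {m ∈ minimalGenerators (edgeIdeal k G) | MvPolynomial.X v ∣ m} =
      (fun a => MvPolynomial.monomial a (1 : k)) '' {e ∈ edgeExponents G | e v ≠ 0} := by
    rw [hE]
    ext m
    constructor
    · rintro ⟨⟨a, ha, rfl⟩, h⟩
      exact ⟨a, ⟨ha, (hX a).1 h⟩, rfl⟩
    · rintro ⟨a, ⟨ha, h⟩, rfl⟩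
      exact ⟨⟨a, ha, rfl⟩, (hX a).2 h⟩
  have hdel : {m ∈ minimalGenerators (edgeIdeal k G) | ¬ MvPolynomial.X v ∣ m} =
      (fun a => MvPolynomial.monomial a (1 : k)) '' {e ∈ edgeExponents G | e v = 0} := by
    rw [hE]
    ext m
    constructor
    · rintro ⟨⟨a, ha, rfl⟩, h⟩
      exact ⟨a, ⟨ha, not_not.1 (mt (hX a).2 h)⟩, rfl⟩
    · rintro ⟨a, ⟨ha, h⟩, rfl⟩
      exact ⟨⟨a, ha, rfl⟩, fun h' => (hX a).1 h' h⟩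
  have hJ' : J = monomialIdeal k {e ∈ edgeExponents G | e v ≠ 0} := by
    rw [hJ, hstar]
    rfl
  have hJmin : minimalGenerators J =
      {m ∈ minimalGenerators (edgeIdeal k G) | MvPolynomial.X v ∣ m} := by
    rw [hstar, hJ', minimalGenerators_monomialIdeal fun _ h => degree_of_mem_edgeExponents h.1]
  have hK2 : K = Ideal.span {m ∈ minimalGenerators (edgeIdeal k G) | ¬ MvPolynomial.X v ∣ m} := by
    rw [hK, hJmin]
    congr 1
    ext m
    exact ⟨fun h => ⟨h.1, fun h' => h.2 ⟨h.1, h'⟩⟩, fun h => ⟨h.1, fun h' => h.2 h'.2⟩⟩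
  have hK' : K = monomialIdeal k {e ∈ edgeExponents G | e v = 0} := by
    rw [hK2, hdel]
    rfl
  have hKmin : minimalGenerators K =
      {m ∈ minimalGenerators (edgeIdeal k G) | ¬ MvPolynomial.X v ∣ m} := by
    rw [hdel, hK', minimalGenerators_monomialIdeal fun _ h => degree_of_mem_edgeExponents h.1]
  have hsup : edgeIdeal k G = J ⊔ K := by
    rw [hJ', hK', ← monomialIdeal_union, edgeIdeal_eq_monomialIdeal]
    congr 1
    ext e
    by_cases h : e v = 0 <;> simp [h]
  have hmono : IsMonomialIdeal (edgeIdeal k G) := by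
    rw [edgeIdeal_eq_monomialIdeal]
    exact isMonomialIdeal_monomialIdeal _
  have hbetti (i : ℕ) (j : Fin n →₀ ℕ) : multigradedBetti (edgeIdeal k G) i j =
      multigradedBetti J i j + multigradedBetti K i j +
        (if i = 0 then 0 else multigradedBetti (J ⊓ K) (i - 1) j) := by
    rw [hsup, hJ', hK']
    exact multigradedBetti_sup (isMonomialIdeal_monomialIdeal _) (isMonomialIdeal_monomialIdeal _) j
      (fun i => isZero_torIdeal_inf_or_star G v i j)
      (fun i => isZero_torIdeal_inf_or_deletion G v i j) i
  refine ⟨⟨hmono, hJ, hK2⟩, hmono, hJ' ▸ isMonomialIdeal_monomialIdeal _,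
    hK' ▸ isMonomialIdeal_monomialIdeal _, hsup, ?_, ?_, hbetti, fun i d => ?_⟩
  · rw [hJmin, hKmin]
    ext m
    by_cases h : MvPolynomial.X v ∣ m <;> simp [h]
  · rw [hJmin, hKmin, Set.disjoint_left]
    exact fun m h h' => h'.2 h.2
  -- The graded identity is the sum of the multigraded ones over all `j` with `|j| = d`.
  · simp only [gradedBetti, hbetti, Finset.sum_add_distrib]
    split_ifs with h
    · simp
    · rfl
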